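/- Let $AP$ be a finite nonempty set of atomic propositions. **Markov chains and trees.** A Markov chain $D=(S,\to,L,s_0)$ has a countable state space $S$, a transition function $S\to \mathrm{Dist}(S)$, a labelling $L:S\to 2^{AP}$ and an initial state $s_0$. A (total) probabilistic tree $T=(W,L,P)$ consists of a set $W\subseteq\mathbb{N}^*\setminus\{\epsilon\}$ of nodes such that $W\cup\{\epsilon\}$ is prefix-closed and exactly one node (the root) has length $1$, a labelling $L:W\to 2^{AP}$, and a function $P:W\to\mathrm{Dist}(W)$ such that $P(\pi)(\pi')>0$ iff $\pi'=\pi\cdot n\in W$ for some $n\in\mathbb{N}$. A tree $T_2=(W_2,L_2,P_2)$ is a *suffix* of $T_1=(W_1,L_1,P_1)$ if there is $\pi_1\in W_1$ such that $\pi_1\cdot\pi_2\in W_1$, $L_2(\pi_2)=L_1(\pi_1\cdot\pi_2)$ and $P_2(\pi_2)(\pi_2')=P_1(\pi_1\cdot\pi_2)(\pi_1\cdot\pi_2')$ for all $\pi_2,\pi_2'\in W_2$. The unfolding $T(D)$ of $D$ is the tree whose nodes are the finite paths of $D$ that start in $s_0$ and follow transitions of positive probability; a node is labelled by the label of its last state,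 and $P(\pi)(\pi\cdot t)$ is the probability of moving from the last state of $\pi$ to $t$. A set $P$ of total probabilistic trees is an *absolute liveness property* if $P\neq\emptyset$ and, whenever $T'\in P$ is a suffix of a tree $T$, also $T\in P$. **PCTL.** State formulas are $\Phi::=a\mid\neg\Phi\mid\Phi\wedge\Phi\mid\Phi\vee\Phi\mid \mathbb{P}_{\bowtie q}(\varphi)$ and path formulas are $\varphi::=\mathsf{X}\Phi\mid\Phi\,\mathsf{U}\,\Phi\mid\Phi\,\mathsf{W}\,\Phi$, where $a\in AP$, ${\bowtie}\in\{<,>,\le,\ge\}$ and $q\in[0,1]$, with the standard semantics over the states and paths of a Markov chain; $\top=a\vee\neg a$ and $\bot=\neg\top$. We write $D\models\Phi$ if $s_0\models\Phi$, and $\Phi\equiv\Psi$ if $D\models\Phi\Leftrightarrow D\models\Psi$ for every Markov chain $D$. The property denoted by $\Phi$ is the set $P_\Phi$ of the trees that are, up to renaming of nodes, of the form $T(D)$ with $D\models\Phi$. **The fragment.** $\mathrm{PCTL}_{\mathit{alive}}$ is the least set $\mathcal F$ of PCTL formulas such that 1. $\top\in\mathcal F$; 2. if $\Phi_1,\Phi_2\in\mathcal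 F$, then $\Phi_1\wedge\Phi_2,\ \Phi_1\vee\Phi_2,\ \mathbb{P}_{>0}(\Phi_1\mathsf{W}\Phi_2)\in\mathcal F$; 3. if $\Phi_2\in\mathcal F$ and $\Phi_1$ is any PCTL formula, then $\mathbb{P}_{>0}(\mathsf{X}\Phi_2),\ \mathbb{P}_{>0}(\Phi_1\mathsf{U}\Phi_2)\in\mathcal F$; 4. if $\Phi_1\in\mathcal F$ and $\Phi_2$ is a PCTL formula with $\neg\Phi_1\wedge\Phi_2\equiv\bot$, then $\mathbb{P}_{>0}(\Phi_1\mathsf{W}\Phi_2)\in\mathcal F$, and, if moreover $\Phi_2\not\equiv\bot$, then $\mathbb{P}_{>0}(\Phi_1\mathsf{U}\Phi_2)\in\mathcal F$. **Theorem.** For every $\Phi\in\mathrm{PCTL}_{\mathit{alive}}$, $P_\Phi$ is an absolute liveness property. Conversely, for every PCTL formula $\Phi$ such that $P_\Phi$ is an absolute liveness property there is $\Phi'\in\mathrm{PCTL}_{\mathit{alive}}$ with $\Phi\equiv\Phi'$; moreover $\Phi'$ can be taken in positive normal form (negation only in front of atomic propositions). -/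

import Mathlib

open MeasureTheory ProbabilityTheory

universe u

/-! ### Markov chains -/

/-- A discrete-time Markov chain with countable state space `S` over the set `AP` of atomic
propositions. A distribution over `S` is a `PMF S`. -/
structure MarkovChain (AP : Type u) (S : Type) where
  countable : Countable S
  /-- transition function -/
  trans : S → PMF S
  /-- labelling function -/
  label : S → Set AP
  /-- initial state -/
  init : S

namespace MarkovChain

variable {AP : Type u} {S : Type}

/-- The kernel choosing the state number `n + 1` of a path from the states number `0, …, n`:
it only looks at the last of them. (`S` carries the discrete `σ`-algebra.) -/
noncomputable def stepKernel (D : MarkovChain AP S) (n : ℕ) :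
    @Kernel (Finset.Iic n → S) S (@MeasurableSpace.pi _ (fun _ => S) fun _ => ⊤) ⊤ :=
  letI : MeasurableSpace S := ⊤
  { toFun := fun h => (D.trans (h ⟨n, Finset.mem_Iic.2 le_rfl⟩)).toMeasure
    measurable' := (measurable_from_top (f := fun s => (D.trans s).toMeasure)).comp
      (measurable_pi_apply _) }

theorem isMarkovKernel_stepKernel (D : MarkovChain AP S) (n : ℕ) :
    @IsMarkovKernel _ _ (@MeasurableSpace.pi _ (fun _ => S) fun _ => ⊤) ⊤ (D.stepKernel n) := by
  let _ : MeasurableSpace S := ⊤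
  exact ⟨fun h => PMF.toMeasure.isProbabilityMeasure _⟩

/-- The probability measure `Pr` on the infinite paths of `D` that start in `s`. It lives on the
`σ`-algebra generated by the cylinder sets; see `pathMeasure_cylinder` for its values there. -/
noncomputable def pathMeasure (D : MarkovChain AP S) (s : S) :
    @Measure (ℕ → S) (@MeasurableSpace.pi _ (fun _ => S) fun _ => ⊤) :=
  letI : MeasurableSpace S := ⊤
  haveI : ∀ n, IsMarkovKernel (D.stepKernel n) := D.isMarkovKernel_stepKernel
  Kernel.traj (X := fun _ => S) D.stepKernel 0 fun _ => s

open Classical in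
/-- The cylinder set of the finite path `π 0, …, π n` has the expected probability. -/
theorem pathMeasure_cylinder (D : MarkovChain AP S) (s : S) (π : ℕ → S) (n : ℕ) :
    D.pathMeasure s {ω | ∀ i ≤ n, ω i = π i} =
      if π 0 = s then ∏ i ∈ Finset.range n, D.trans (π i) (π (i + 1)) else 0 := by
  let _ : MeasurableSpace S := ⊤
  have : Countable S := D.countable
  have : ∀ n, IsMarkovKernel (D.stepKernel n) := D.isMarkovKernel_stepKernel
  induction n with
  | zero =>
    have h := Kernel.traj_map_frestrictLe_apply (X := fun _ => S) (κ := D.stepKernel) 0 0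
      (fun _ => s)
    have hm : MeasurableSet {x : Finset.Iic 0 → S | x ⟨0, by simp⟩ = π 0} :=
      (measurable_pi_apply _) (measurableSet_singleton _)
    have h2 := congrArg (fun μ => μ {x : Finset.Iic 0 → S | x ⟨0, by simp⟩ = π 0}) h
    simp only [Kernel.partialTraj_self, Kernel.id_apply] at h2
    rw [Measure.map_apply (by fun_prop) hm, Measure.dirac_apply' _ hm] at h2
    have e : {ω : ℕ → S | ∀ i ≤ 0, ω i = π i} =
        Preorder.frestrictLe (π := fun _ => S) 0 ⁻¹' {x | x ⟨0, by simp⟩ = π 0} := by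
      ext ω; simp
    rw [e]
    refine Eq.trans h2 ?_
    simp [Set.indicator_apply, eq_comm]
  | succ n ih =>
    have h := Kernel.partialTraj_compProd_eq_map_traj (X := fun _ => S) (κ := D.stepKernel)
      (Nat.zero_le n) (x₀ := fun _ => s)
    set A : Set (Finset.Iic n → S) := {x | ∀ i : Finset.Iic n, x i = π i} with hA
    have hAm : MeasurableSet A := by
      have hA' : A = {fun i : Finset.Iic n => π i} := by
        ext x; simp [hA, funext_iff]
      rw [hA']; exact measurableSet_singleton _
    have hB : MeasurableSet ({π (n + 1)} : Set S) := measurableSet_singleton _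
    have h2 := congrArg (fun μ => μ (A ×ˢ {π (n + 1)})) h
    rw [Measure.compProd_apply_prod hAm hB,
      Measure.map_apply (by fun_prop) (hAm.prod hB)] at h2
    have e : {ω : ℕ → S | ∀ i ≤ n + 1, ω i = π i} =
        (fun x : ℕ → S => (Preorder.frestrictLe (π := fun _ => S) n x, x (n + 1))) ⁻¹'
          (A ×ˢ {π (n + 1)}) := by
      ext ω
      simp only [Set.mem_ofPred_eq, Set.mem_preimage, Set.mem_prod, hA, Set.mem_singleton_iff,
        Preorder.frestrictLe_apply, Subtype.forall, Finset.mem_Iic]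
      constructor
      · exact fun H => ⟨fun i hi => H i (by omega), H _ le_rfl⟩
      · rintro ⟨H, H'⟩ i hi
        rcases Nat.lt_or_ge n i with hi' | hi'
        · obtain rfl : i = n + 1 := by omega
          exact H'
        · exact H i hi'
    have e' : {ω : ℕ → S | ∀ i ≤ n, ω i = π i} =
        Preorder.frestrictLe (π := fun _ => S) n ⁻¹' A := by
      ext ω; simp [hA]
    have h3 := Kernel.traj_map_frestrictLe_apply (X := fun _ => S) (κ := D.stepKernel) 0 n
      (fun _ => s)
    have h4 := congrArg (fun μ => μ A) h3
    rw [Measure.map_apply (by fun_prop) hAm, ← e'] at h4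
    rw [e]
    refine Eq.trans h2.symm ?_
    rw [setLIntegral_congr_fun (g := fun _ => D.trans (π n) (π (n + 1))) hAm, setLIntegral_const,
      ← h4]
    · refine Eq.trans (congrArg _ ih) ?_
      split_ifs
      · rw [Finset.prod_range_succ, mul_comm]
      · simp
    · intro x hx
      have : x ⟨n, Finset.mem_Iic.2 le_rfl⟩ = π n := hx _
      change (D.trans (x ⟨n, Finset.mem_Iic.2 le_rfl⟩)).toMeasure {π (n + 1)} = _
      rw [this, PMF.toMeasure_apply_singleton _ _ hB]

end MarkovChain

/-! ### Probabilistic CTL -/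

/-- The comparison operators `<`, `>`, `≤`, `≥`. -/
inductive Comparison
  | lt | gt | le | ge

/-- `c.Holds x q` means `x ⋈ q`. -/
def Comparison.Holds : Comparison → ℝ → ℝ → Prop
  | .lt, x, q => x < q
  | .gt, x, q => x > q
  | .le, x, q => x ≤ q
  | .ge, x, q => x ≥ q

mutual

/-- State formulas of PCTL. Disjunction is taken as a primitive connective because positive normal
forms need it. -/
inductive StateFormula (AP : Type u) : Type u
  | atom (a : AP) : StateFormula AP
  | neg (Φ : StateFormula AP) : StateFormula AP
  | and (Φ₁ Φ₂ : StateFormula AP) : StateFormula AP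
  | or (Φ₁ Φ₂ : StateFormula AP) : StateFormula AP
  | prob (c : Comparison) (q : Set.Icc (0 : ℝ) 1) (φ : PathFormula AP) : StateFormula AP

/-- Path formulas of PCTL: next `X Φ`, until `Φ₁ U Φ₂` and weak until `Φ₁ W Φ₂`. -/
inductive PathFormula (AP : Type u) : Type u
  | next (Φ : StateFormula AP) : PathFormula AP
  | until (Φ₁ Φ₂ : StateFormula AP) : PathFormula AP
  | weakUntil (Φ₁ Φ₂ : StateFormula AP) : PathFormula AP

end

namespace StateFormula

variable {AP : Type u}

/-- `⊤`, written `a ∨ ¬ a`; which atomic proposition `a` is used does not matter. -/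
def top (a : AP) : StateFormula AP := or (atom a) (neg (atom a))

/-- `⊥ = ¬ ⊤`. -/
def bot (a : AP) : StateFormula AP := neg (top a)

/-- `P_{>0}(φ)`. -/
def probPos (φ : PathFormula AP) : StateFormula AP := prob .gt ⟨0, by simp⟩ φ

end StateFormula

mutual

/-- `StateFormula.Sat D Φ s` is `s ⊨ Φ`. -/
def StateFormula.Sat {AP : Type u} {S : Type} (D : MarkovChain AP S) :
    StateFormula AP → S → Prop
  | .atom a, s => a ∈ D.label s
  | .neg Φ, s => ¬ StateFormula.Sat D Φ s
  | .and Φ₁ Φ₂, s => StateFormula.Sat D Φ₁ s ∧ StateFormula.Sat D Φ₂ s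
  | .or Φ₁ Φ₂, s => StateFormula.Sat D Φ₁ s ∨ StateFormula.Sat D Φ₂ s
  | .prob c q φ, s =>
      c.Holds (D.pathMeasure s {ω | ω 0 = s ∧ PathFormula.Sat D φ ω}).toReal q

/-- `PathFormula.Sat D φ ω` is `ω ⊨ φ`. -/
def PathFormula.Sat {AP : Type u} {S : Type} (D : MarkovChain AP S) :
    PathFormula AP → (ℕ → S) → Prop
  | .next Φ, ω => StateFormula.Sat D Φ (ω 1)
  | .until Φ₁ Φ₂, ω =>
      ∃ j, StateFormula.Sat D Φ₂ (ω j) ∧ ∀ k < j, StateFormula.Sat D Φ₁ (ω k)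
  | .weakUntil Φ₁ Φ₂, ω =>
      (∃ j, StateFormula.Sat D Φ₂ (ω j) ∧ ∀ k < j, StateFormula.Sat D Φ₁ (ω k)) ∨
        ∀ i, StateFormula.Sat D Φ₁ (ω i)

end

mutual

/-- Positive normal form: negation occurs only in front of atomic propositions. -/
def StateFormula.IsPNF {AP : Type u} : StateFormula AP → Prop
  | .atom _ => True
  | .neg Φ => ∃ a, Φ = .atom a
  | .and Φ₁ Φ₂ => StateFormula.IsPNF Φ₁ ∧ StateFormula.IsPNF Φ₂
  | .or Φ₁ Φ₂ => StateFormula.IsPNF Φ₁ ∧ StateFormula.IsPNF Φ₂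
  | .prob _ _ φ => PathFormula.IsPNF φ

/-- Positive normal form for path formulas. -/
def PathFormula.IsPNF {AP : Type u} : PathFormula AP → Prop
  | .next Φ => StateFormula.IsPNF Φ
  | .until Φ₁ Φ₂ => StateFormula.IsPNF Φ₁ ∧ StateFormula.IsPNF Φ₂
  | .weakUntil Φ₁ Φ₂ => StateFormula.IsPNF Φ₁ ∧ StateFormula.IsPNF Φ₂

end

/-- `D ⊨ Φ`: the initial state of `D` satisfies `Φ`. -/
def MarkovChain.Models {AP : Type u} {S : Type} (D : MarkovChain AP S) (Φ : StateFormula AP) :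
    Prop :=
  Φ.Sat D D.init

/-- `Φ ≡ Ψ`: the two formulas hold in the same Markov chains. -/
def StateFormula.Equivalent {AP : Type u} (Φ Ψ : StateFormula AP) : Prop :=
  ∀ (S : Type) (D : MarkovChain AP S), D.Models Φ ↔ D.Models Ψ

/-! ### Probabilistic trees -/

/-- A total probabilistic tree over `AP` with nodes in `N*`. Every node carries a distribution whose
support is the set of its children, so every node has a child. Only the values of `label` and `prob`
at nodes matter; all notions below use only these. -/
structure ProbTree (AP : Type u) (N : Type) where
  /-- the set `W` of nodes -/
  nodes : Set (List N)
  nil_notMem : [] ∉ nodes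
  prefix_closed : ∀ π ∈ nodes, ∀ π', π' <+: π → π' ≠ [] → π' ∈ nodes
  existsUnique_root : ∃! n, [n] ∈ nodes
  /-- node labelling -/
  label : List N → Set AP
  /-- edge labelling -/
  prob : List N → PMF (List N)
  prob_pos_iff : ∀ π ∈ nodes, ∀ π', 0 < prob π π' ↔ (∃ n, π' = π ++ [n]) ∧ π' ∈ nodes

namespace ProbTree

variable {AP : Type u} {N N' : Type}

/-- `T₂` is a suffix of `T₁`. -/
def IsSuffix (T₂ T₁ : ProbTree AP N) : Prop :=
  ∃ π₁ ∈ T₁.nodes,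
    (∀ π₂ ∈ T₂.nodes, π₁ ++ π₂ ∈ T₁.nodes) ∧
    (∀ π₂ ∈ T₂.nodes, T₂.label π₂ = T₁.label (π₁ ++ π₂)) ∧
    ∀ π₂ ∈ T₂.nodes, ∀ π₂' ∈ T₂.nodes, T₂.prob π₂ π₂' = T₁.prob (π₁ ++ π₂) (π₁ ++ π₂')

/-- Two probabilistic trees are isomorphic if they agree up to renaming the nodes. -/
def Isomorphic (T : ProbTree AP N) (T' : ProbTree AP N') : Prop :=
  ∃ f : T.nodes ≃ T'.nodes,
    (∀ π π' : T.nodes, π.1 <+: π'.1 ↔ (f π).1 <+: (f π').1) ∧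
    (∀ π : T.nodes, T.label π = T'.label (f π)) ∧
    ∀ π π' : T.nodes, T.prob π π' = T'.prob (f π) (f π')

end ProbTree

/-- The least set of finite paths containing the initial state and closed under appending a state
that the last state reaches with positive probability. -/
inductive MarkovChain.IsUnfoldingNode {AP : Type u} {S : Type} (D : MarkovChain AP S) :
    List S → Prop
  | root : IsUnfoldingNode D [D.init]
  | step (π : List S) (s t : S) : IsUnfoldingNode D (π ++ [s]) → t ∈ (D.trans s).support →
      IsUnfoldingNode D (π ++ [s] ++ [t])

theorem MarkovChain.IsUnfoldingNode.exists_cons {AP : Type u} {S : Type} {D : MarkovChain AP S}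
    {π : List S} (h : D.IsUnfoldingNode π) : ∃ l, π = D.init :: l := by
  induction h with
  | root => exact ⟨[], rfl⟩
  | step π s t _ _ ih =>
    obtain ⟨l, hl⟩ := ih
    exact ⟨l ++ [t], by rw [hl]; rfl⟩

/-- The unfolding `T(D)` of a Markov chain. (The default `D.init` is only used at the empty list,
which is not a node.) -/
noncomputable def MarkovChain.unfolding {AP : Type u} {S : Type} (D : MarkovChain AP S) :
    ProbTree AP S where
  nodes := {π | D.IsUnfoldingNode π}
  nil_notMem := fun h => by obtain ⟨l, hl⟩ := h.exists_cons; simp at hl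
  prefix_closed := by
    intro π h
    induction h with
    | root =>
      intro π' hp hne
      rcases List.prefix_cons_iff.1 hp with rfl | ⟨t, rfl, ht⟩
      · exact absurd rfl hne
      · rw [List.prefix_nil.1 ht]; exact .root
    | step π s t h₁ h₂ ih =>
      intro π' hp hne
      rcases List.prefix_concat_iff.1 hp with rfl | hp
      · exact MarkovChain.IsUnfoldingNode.step π s t h₁ h₂
      · exact ih π' hp hne
  existsUnique_root := ⟨D.init, .root, fun n h => by
    obtain ⟨l, hl⟩ := MarkovChain.IsUnfoldingNode.exists_cons h
    exact (List.cons.inj hl).1⟩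
  label := fun π => D.label (π.getLastD D.init)
  prob := fun π => (D.trans (π.getLastD D.init)).map fun t => π ++ [t]
  prob_pos_iff := by
    intro π h π'
    have hne : π ≠ [] := by
      obtain ⟨l, hl⟩ := MarkovChain.IsUnfoldingNode.exists_cons h; simp [hl]
    obtain ⟨ρ, s, rfl⟩ : ∃ ρ s, π = ρ ++ [s] := ⟨_, _, (List.dropLast_append_getLast hne).symm⟩
    rw [pos_iff_ne_zero, ← PMF.mem_support_iff, PMF.support_map]
    have hl : (ρ ++ [s]).getLastD D.init = s := by simp
    rw [hl]
    constructor
    · rintro ⟨t, ht, rfl⟩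
      exact ⟨⟨t, rfl⟩, MarkovChain.IsUnfoldingNode.step ρ s t h ht⟩
    · rintro ⟨⟨t, rfl⟩, ht⟩
      refine ⟨t, ?_, rfl⟩
      generalize hx : ρ ++ [s] ++ [t] = x at ht
      cases ht with
      | root => exact absurd (congrArg List.length hx) (by simp)
      | step ρ' s' t' h₁ h₂ =>
        obtain ⟨h₃, h₄⟩ := List.append_inj' hx rfl
        obtain ⟨-, h₅⟩ := List.append_inj' h₃ rfl
        simp only [List.cons.injEq, and_true] at h₄ h₅
        subst h₄ h₅
        exact h₂

/-! ### Properties, absolute liveness and the fragment `PCTL_alive` -/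

/-- The property `P_Φ` of total probabilistic trees over `ℕ` denoted by `Φ`: the unfoldings of the
Markov chains that satisfy `Φ`, up to renaming of nodes (the state space of a Markov chain is an
arbitrary countable set, and not every tree over `ℕ` is literally an unfolding). -/
def StateFormula.property {AP : Type u} (Φ : StateFormula AP) : Set (ProbTree AP ℕ) :=
  {T | ∃ (S : Type) (D : MarkovChain AP S), D.Models Φ ∧ T.Isomorphic D.unfolding}

/-- Absolute liveness: nonempty, and containing every tree that has a suffix in it. -/
def IsAbsoluteLiveness {AP : Type u} (P : Set (ProbTree AP ℕ)) : Prop :=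
  P.Nonempty ∧ ∀ T T' : ProbTree AP ℕ, T'.IsSuffix T → T' ∈ P → T ∈ P

/-- The fragment `PCTL_alive`. The side condition `Φ₂ ≢ ⊥` of `until_of_left` keeps formulas
equivalent to `⊥`, such as `P_{>0}(⊤ U ⊥)`, out of the fragment. -/
inductive PCTLAlive {AP : Type u} : StateFormula AP → Prop
  | top (a : AP) : PCTLAlive (.top a)
  | and {Φ₁ Φ₂ : StateFormula AP} : PCTLAlive Φ₁ → PCTLAlive Φ₂ → PCTLAlive (.and Φ₁ Φ₂)
  | or {Φ₁ Φ₂ : StateFormula AP} : PCTLAlive Φ₁ → PCTLAlive Φ₂ → PCTLAlive (.or Φ₁ Φ₂)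
  | weakUntil {Φ₁ Φ₂ : StateFormula AP} : PCTLAlive Φ₁ → PCTLAlive Φ₂ →
      PCTLAlive (.probPos (.weakUntil Φ₁ Φ₂))
  | next {Φ₂ : StateFormula AP} : PCTLAlive Φ₂ → PCTLAlive (.probPos (.next Φ₂))
  | until_of_right (Φ₁ : StateFormula AP) {Φ₂ : StateFormula AP} : PCTLAlive Φ₂ →
      PCTLAlive (.probPos (.until Φ₁ Φ₂))
  | until_of_left {Φ₁ Φ₂ : StateFormula AP} (a : AP) : PCTLAlive Φ₁ →
      (StateFormula.and (.neg Φ₁) Φ₂).Equivalent (.bot a) → ¬ Φ₂.Equivalent (.bot a) →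
      PCTLAlive (.probPos (.until Φ₁ Φ₂))
  | weakUntil_of_left {Φ₁ Φ₂ : StateFormula AP} (a : AP) : PCTLAlive Φ₁ →
      (StateFormula.and (.neg Φ₁) Φ₂).Equivalent (.bot a) →
      PCTLAlive (.probPos (.weakUntil Φ₁ Φ₂))

/-- The product `σ`-algebra on the sequences over a discrete space `S`. -/
abbrev pathSpace (S : Type) : MeasurableSpace (ℕ → S) :=
  @MeasurableSpace.pi _ (fun _ => S) fun _ => ⊤

/-- The sequence with head `s` and tail `ω`. -/
def consPath {S : Type} (s : S) (ω : ℕ → S) : ℕ → S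
  | 0 => s
  | n + 1 => ω n

theorem measurable_consPath {S : Type} (s : S) :
    Measurable[pathSpace S, pathSpace S] (consPath s) := by
  let _ : MeasurableSpace S := ⊤
  refine measurable_pi_iff.2 fun n => ?_
  cases n with
  | zero => exact measurable_const
  | succ n => exact measurable_pi_apply n

theorem measurable_comp_path {S S' : Type} (f : S → S') :
    Measurable[pathSpace S, pathSpace S'] (fun ω : ℕ → S => f ∘ ω) := by
  let _ : MeasurableSpace S := ⊤
  let _ : MeasurableSpace S' := ⊤
  exact measurable_pi_iff.2 fun n => (measurable_from_top (f := f)).comp (measurable_pi_apply n)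

theorem measurableSet_apply_mem {S : Type} (n : ℕ) (B : Set S) :
    MeasurableSet[pathSpace S] {ω | ω n ∈ B} := by
  let _ : MeasurableSpace S := ⊤
  exact (measurable_pi_apply n) (MeasurableSpace.measurableSet_top (s := B))

theorem measurableSet_pathCylinder {S : Type} (n : ℕ) (π : ℕ → S) :
    MeasurableSet[pathSpace S] {ω | ∀ i ≤ n, ω i = π i} := by
  have : {ω : ℕ → S | ∀ i ≤ n, ω i = π i} = ⋂ i, ⋂ (_ : i ≤ n), {ω | ω i ∈ ({π i} : Set S)} := by
    ext ω; simp
  rw [this]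
  exact MeasurableSet.iInter fun i => MeasurableSet.iInter fun _ => measurableSet_apply_mem i _

/-- A finite measure on the sequences over a countable discrete space is determined by its values
on the cylinder sets. -/
theorem measure_ext_of_cylinder {S : Type} [Countable S]
    {μ ν : @Measure (ℕ → S) (pathSpace S)} (hν : @IsFiniteMeasure _ (pathSpace S) ν)
    (h : ∀ (n : ℕ) (π : ℕ → S), μ {ω | ∀ i ≤ n, ω i = π i} = ν {ω | ∀ i ≤ n, ω i = π i}) : μ = ν := by
  let _ : MeasurableSpace S := ⊤
  let P : (I : Finset ℕ) → Measure (∀ _ : I, S) := fun I => ν.map I.restrict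
  have hP : IsProjectiveMeasureFamily (α := fun _ => S) P := by
    intro I J hJI
    change ν.map _ = (ν.map _).map _
    rw [Measure.map_map (by fun_prop) (by fun_prop)]
    rfl
  have h2 : IsProjectiveLimit (α := fun _ => S) ν P := fun I => rfl
  have h1 : IsProjectiveLimit (α := fun _ => S) μ P := by
    refine (isProjectiveLimit_nat_iff (X := fun _ => S) hP μ).2 fun n => ?_
    refine Measure.ext_of_singleton fun x => ?_
    change μ.map _ _ = ν.map _ _
    rw [Measure.map_apply (by fun_prop) (measurableSet_singleton _),
      Measure.map_apply (by fun_prop) (measurableSet_singleton _)]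
    by_cases hS : Nonempty S
    · obtain ⟨s⟩ := hS
      have e : (Preorder.frestrictLe (π := fun _ => S) n) ⁻¹' {x} =
          {ω : ℕ → S | ∀ i ≤ n, ω i =
            (fun i => if hi : i ∈ Finset.Iic n then x ⟨i, hi⟩ else s) i} := by
        ext ω
        simp only [Set.mem_preimage, Set.mem_singleton_iff, funext_iff, Subtype.forall,
          Preorder.frestrictLe_apply, Finset.mem_Iic]
        refine forall_congr' fun i => forall_congr' fun hi => ?_
        simp [hi]
      have e' : (Finset.Iic n).restrict (π := fun _ => S) ⁻¹' {x} =
          (Preorder.frestrictLe (π := fun _ => S) n) ⁻¹' {x} := rfl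
      rw [e', e]
      exact h n _
    · exact absurd ⟨x ⟨0, by simp⟩⟩ hS
  have : ∀ I, IsFiniteMeasure (P I) := fun I => by
    change IsFiniteMeasure (ν.map _); infer_instance
  exact IsProjectiveLimit.unique h1 h2

namespace MarkovChain

variable {AP : Type u} {S : Type}

theorem isProbabilityMeasure_pathMeasure (D : MarkovChain AP S) (s : S) :
    @IsProbabilityMeasure _ (pathSpace S) (D.pathMeasure s) := by
  let _ : MeasurableSpace S := ⊤
  have : ∀ n, IsMarkovKernel (D.stepKernel n) := D.isMarkovKernel_stepKernel
  change IsProbabilityMeasure (Kernel.traj (X := fun _ => S) D.stepKernel 0 fun _ => s)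
  infer_instance

/-- The Markov property at the first step. -/
theorem pathMeasure_eq_sum (D : MarkovChain AP S) (s : S) :
    D.pathMeasure s = @Measure.sum _ _ (pathSpace S) fun t => D.trans s t •
      @Measure.map _ _ (pathSpace S) (pathSpace S) (consPath s) (D.pathMeasure t) := by
  classical
  let _ : MeasurableSpace S := ⊤
  have : Countable S := D.countable
  have := D.isProbabilityMeasure_pathMeasure
  symm
  refine measure_ext_of_cylinder (ν := D.pathMeasure s) inferInstance fun n π => ?_
  rw [Measure.sum_apply _ (measurableSet_pathCylinder n π), pathMeasure_cylinder]
  simp only [Measure.smul_apply, smul_eq_mul,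
    Measure.map_apply (measurable_consPath s) (measurableSet_pathCylinder n π)]
  by_cases hs : π 0 = s
  · rw [if_pos hs]
    cases n with
    | zero =>
      have : (consPath s ⁻¹' {ω | ∀ i ≤ 0, ω i = π i}) = Set.univ := by
        ext ω; simp [consPath, hs]
      simp only [this, measure_univ, mul_one, (D.trans s).tsum_coe, Finset.range_zero,
        Finset.prod_empty]
    | succ n =>
      have : (consPath s ⁻¹' {ω | ∀ i ≤ n + 1, ω i = π i}) =
          {ω | ∀ i ≤ n, ω i = (fun i => π (i + 1)) i} := by
        ext ω
        constructor
        · exact fun h i hi => h (i + 1) (by omega)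
        · rintro h (_ | i) hi
          · exact hs.symm
          · exact h i (by omega)
      rw [this, tsum_eq_single (π 1)]
      · rw [pathMeasure_cylinder, if_pos (by simp), Finset.prod_range_succ', mul_comm, hs]
      · intro t ht
        rw [pathMeasure_cylinder, if_neg (by simpa using ht.symm), mul_zero]
  · rw [if_neg hs]
    have : (consPath s ⁻¹' {ω | ∀ i ≤ n, ω i = π i}) = ∅ := by
      ext ω
      simp only [Set.mem_preimage, Set.mem_ofPred_eq, Set.mem_empty_iff_false, iff_false]
      exact fun h => hs (h 0 (Nat.zero_le n)).symm
    simp [this]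

theorem pathMeasure_eq_tsum (D : MarkovChain AP S) (s : S) {A : Set (ℕ → S)}
    (hA : MeasurableSet[pathSpace S] A) :
    D.pathMeasure s A = ∑' t, D.trans s t * D.pathMeasure t (consPath s ⁻¹' A) := by
  let _ : MeasurableSpace S := ⊤
  conv_lhs => rw [pathMeasure_eq_sum, Measure.sum_apply _ hA]
  simp only [Measure.smul_apply, smul_eq_mul, Measure.map_apply (measurable_consPath s) hA]

theorem pathMeasure_ne_zero_iff_exists (D : MarkovChain AP S) (s : S) {A : Set (ℕ → S)}
    (hA : MeasurableSet[pathSpace S] A) :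
    D.pathMeasure s A ≠ 0 ↔
      ∃ t ∈ (D.trans s).support, D.pathMeasure t (consPath s ⁻¹' A) ≠ 0 := by
  rw [pathMeasure_eq_tsum D s hA, Ne, ENNReal.tsum_eq_zero]
  simp [PMF.mem_support_iff]

/-- Paths start in the prescribed state. -/
theorem pathMeasure_inter_start (D : MarkovChain AP S) (s : S) (A : Set (ℕ → S)) :
    D.pathMeasure s {ω | ω 0 = s ∧ ω ∈ A} = D.pathMeasure s A := by
  classical
  let _ : MeasurableSpace S := ⊤
  have := D.isProbabilityMeasure_pathMeasure s
  have h1 : D.pathMeasure s {ω | ω 0 = s} = 1 := by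
    have := D.pathMeasure_cylinder s (fun _ => s) 0
    simpa using this
  have hm : MeasurableSet {ω : ℕ → S | ω 0 = s} := measurableSet_apply_mem 0 {s}
  have h2 : ∀ᵐ ω ∂(D.pathMeasure s), ω 0 = s := (prob_compl_eq_zero_iff hm).2 h1
  refine measure_congr ?_
  filter_upwards [h2] with ω hω
  exact propext ⟨fun h => h.2, fun h => ⟨hω, h⟩⟩

/-- Functions that preserve transitions push path measures forward to path measures. -/
theorem map_pathMeasure {S' : Type} {D : MarkovChain AP S} {D' : MarkovChain AP S'} (f : S → S')
    {C : Set S} (hC : ∀ s ∈ C, ∀ t ∈ (D.trans s).support, t ∈ C)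
    (hf : ∀ s ∈ C, D'.trans (f s) = (D.trans s).map f) {s : S} (hs : s ∈ C) :
    @Measure.map _ _ (pathSpace S) (pathSpace S') (fun ω => f ∘ ω) (D.pathMeasure s) =
      D'.pathMeasure (f s) := by
  classical
  let _ : MeasurableSpace S := ⊤
  let _ : MeasurableSpace S' := ⊤
  have : Countable S' := D'.countable
  have hp := D'.isProbabilityMeasure_pathMeasure
  refine measure_ext_of_cylinder (ν := D'.pathMeasure (f s)) inferInstance fun n π => ?_
  rw [Measure.map_apply (measurable_comp_path f) (measurableSet_pathCylinder n π)]
  induction n generalizing s π with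
  | zero =>
    rw [← pathMeasure_inter_start, ← pathMeasure_inter_start D']
    have hq := D.isProbabilityMeasure_pathMeasure
    by_cases h : f s = π 0
    · have e1 : {ω | ω 0 = s ∧ ω ∈ (fun ω => f ∘ ω) ⁻¹' {ω | ∀ i ≤ 0, ω i = π i}} =
          {ω | ω 0 = s ∧ ω ∈ Set.univ} := by
        ext ω; simp only [Set.mem_ofPred_eq, Set.mem_preimage, Set.mem_univ]
        refine and_congr_right fun h0 => ?_
        simp [h0, h]
      have e2 : {ω : ℕ → S' | ω 0 = f s ∧ ω ∈ {ω | ∀ i ≤ 0, ω i = π i}} =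
          {ω : ℕ → S' | ω 0 = f s ∧ ω ∈ Set.univ} := by
        ext ω; simp only [Set.mem_ofPred_eq, Set.mem_univ]
        refine and_congr_right fun h0 => ?_
        simp [h0, h]
      rw [e1, e2, pathMeasure_inter_start, pathMeasure_inter_start, measure_univ, measure_univ]
    · have e1 : {ω | ω 0 = s ∧ ω ∈ (fun ω => f ∘ ω) ⁻¹' {ω | ∀ i ≤ 0, ω i = π i}} = ∅ := by
        ext ω; simp only [Set.mem_ofPred_eq, Set.mem_preimage, Set.mem_empty_iff_false, iff_false]
        rintro ⟨h0, h1⟩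
        exact h (by simpa [h0] using h1 0 le_rfl)
      have e2 : {ω : ℕ → S' | ω 0 = f s ∧ ω ∈ {ω | ∀ i ≤ 0, ω i = π i}} = ∅ := by
        ext ω; simp only [Set.mem_ofPred_eq, Set.mem_empty_iff_false, iff_false]
        rintro ⟨h0, h1⟩
        exact h (by simpa [h0] using h1 0 le_rfl)
      rw [e1, e2, measure_empty, measure_empty]
  | succ n ih =>
    rw [pathMeasure_eq_tsum _ _ (measurable_comp_path f (measurableSet_pathCylinder _ π)),
      pathMeasure_eq_tsum _ _ (measurableSet_pathCylinder _ π)]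
    by_cases h : f s = π 0
    · have e1 : consPath s ⁻¹' ((fun ω => f ∘ ω) ⁻¹' {ω | ∀ i ≤ n + 1, ω i = π i}) =
          (fun ω => f ∘ ω) ⁻¹' {ω | ∀ i ≤ n, ω i = (fun i => π (i + 1)) i} := by
        ext ω
        constructor
        · exact fun h i hi => h (i + 1) (by omega)
        · rintro h' (_ | i) hi
          · exact h
          · exact h' i (by omega)
      have e2 : consPath (f s) ⁻¹' {ω | ∀ i ≤ n + 1, ω i = π i} =
          {ω | ∀ i ≤ n, ω i = (fun i => π (i + 1)) i} := by
        ext ω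
        constructor
        · exact fun h i hi => h (i + 1) (by omega)
        · rintro h' (_ | i) hi
          · exact h
          · exact h' i (by omega)
      rw [e1, e2, hf s hs]
      simp only [PMF.map_apply, ← ENNReal.tsum_mul_right]
      rw [ENNReal.tsum_comm]
      refine tsum_congr fun t => ?_
      rw [tsum_eq_single (f t) (fun b hb => by rw [if_neg hb, zero_mul]), if_pos rfl]
      by_cases ht : t ∈ (D.trans s).support
      · rw [ih (hC s hs t ht)]
      · rw [PMF.mem_support_iff, not_not] at ht
        rw [ht, zero_mul, zero_mul]
    · have e1 : consPath s ⁻¹' ((fun ω => f ∘ ω) ⁻¹' {ω | ∀ i ≤ n + 1, ω i = π i}) = ∅ := by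
        ext ω
        simp only [Set.mem_preimage, Set.mem_ofPred_eq, Set.mem_empty_iff_false, iff_false]
        exact fun h' => h (h' 0 (Nat.zero_le _))
      have e2 : consPath (f s) ⁻¹' {ω | ∀ i ≤ n + 1, ω i = π i} = ∅ := by
        ext ω
        simp only [Set.mem_preimage, Set.mem_ofPred_eq, Set.mem_empty_iff_false, iff_false]
        exact fun h' => h (h' 0 (Nat.zero_le _))
      simp only [e1, e2, measure_empty, mul_zero, tsum_zero]

end MarkovChain

namespace MarkovChain

variable {AP : Type u} {S : Type}

theorem measurableSet_pathSat (D : MarkovChain AP S) (φ : PathFormula AP) :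
    MeasurableSet[pathSpace S] {ω | φ.Sat D ω} := by
  have hU : ∀ A B : Set S,
      MeasurableSet[pathSpace S] {ω | ∃ j, ω j ∈ B ∧ ∀ k < j, ω k ∈ A} := by
    intro A B
    have : {ω : ℕ → S | ∃ j, ω j ∈ B ∧ ∀ k < j, ω k ∈ A} =
        ⋃ j, ({ω | ω j ∈ B} ∩ ⋂ k, ⋂ (_ : k < j), {ω | ω k ∈ A}) := by
      ext ω; simp
    rw [this]
    exact MeasurableSet.iUnion fun j => (measurableSet_apply_mem j B).inter
      (MeasurableSet.iInter fun k => MeasurableSet.iInter fun _ => measurableSet_apply_mem k A)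
  rcases φ with Φ | ⟨Φ₁, Φ₂⟩ | ⟨Φ₁, Φ₂⟩
  · exact measurableSet_apply_mem 1 {s | Φ.Sat D s}
  · exact hU {s | Φ₁.Sat D s} {s | Φ₂.Sat D s}
  · refine (hU {s | Φ₁.Sat D s} {s | Φ₂.Sat D s}).union ?_
    have : {ω : ℕ → S | ∀ i, Φ₁.Sat D (ω i)} = ⋂ i, {ω | ω i ∈ {s | Φ₁.Sat D s}} := by
      ext ω; simp
    change MeasurableSet[pathSpace S] {ω : ℕ → S | ∀ i, Φ₁.Sat D (ω i)}
    rw [this]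
    exact MeasurableSet.iInter fun i => measurableSet_apply_mem i _

theorem sat_prob (D : MarkovChain AP S) (c : Comparison) (q : Set.Icc (0 : ℝ) 1)
    (φ : PathFormula AP) (s : S) :
    (StateFormula.prob c q φ).Sat D s ↔
      c.Holds (D.pathMeasure s {ω | φ.Sat D ω}).toReal q := by
  rw [← pathMeasure_inter_start]
  rfl

theorem sat_probPos (D : MarkovChain AP S) (φ : PathFormula AP) (s : S) :
    (StateFormula.probPos φ).Sat D s ↔ D.pathMeasure s {ω | φ.Sat D ω} ≠ 0 := by
  let _ : MeasurableSpace S := ⊤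
  have := D.isProbabilityMeasure_pathMeasure s
  rw [StateFormula.probPos, sat_prob]
  change 0 < _ ↔ _
  rw [ENNReal.toReal_pos_iff, pos_iff_ne_zero]
  exact and_iff_left (measure_lt_top _ _)

theorem sat_top (D : MarkovChain AP S) (a : AP) (s : S) : (StateFormula.top a).Sat D s :=
  em (a ∈ D.label s)

theorem not_sat_bot (D : MarkovChain AP S) (a : AP) (s : S) : ¬ (StateFormula.bot a).Sat D s :=
  fun h => h (D.sat_top a s)

/-- A set of states closed under predecessors contains every state from which it is reached with
positive probability. -/
theorem mem_of_pathMeasure_ne_zero (D : MarkovChain AP S) {B : Set S}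
    (hB : ∀ s, ∀ t ∈ (D.trans s).support, t ∈ B → s ∈ B) (n : ℕ) {s : S}
    (h : D.pathMeasure s {ω | ω n ∈ B} ≠ 0) : s ∈ B := by
  induction n generalizing s with
  | zero =>
    by_contra hs
    rw [← pathMeasure_inter_start] at h
    have : {ω : ℕ → S | ω 0 = s ∧ ω ∈ {ω | ω 0 ∈ B}} = ∅ := by
      ext ω
      simp only [Set.mem_ofPred_eq, Set.mem_empty_iff_false, iff_false]
      rintro ⟨h0, h1⟩
      exact hs (h0 ▸ h1)
    rw [this] at h
    exact h measure_empty
  | succ n ih =>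
    obtain ⟨t, ht, h'⟩ := (D.pathMeasure_ne_zero_iff_exists s (measurableSet_apply_mem _ B)).1 h
    exact hB s t ht (ih h')

theorem mem_of_pathMeasure_exists_ne_zero (D : MarkovChain AP S) {B : Set S}
    (hB : ∀ s, ∀ t ∈ (D.trans s).support, t ∈ B → s ∈ B) {s : S}
    (h : D.pathMeasure s {ω | ∃ n, ω n ∈ B} ≠ 0) : s ∈ B := by
  by_contra hs
  refine h ?_
  rw [show {ω : ℕ → S | ∃ n, ω n ∈ B} = ⋃ n, {ω | ω n ∈ B} by ext; simp]
  refine measure_iUnion_null fun n => ?_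
  by_contra h'
  exact hs (D.mem_of_pathMeasure_ne_zero hB n h')

/-- `F` preserves labels and transitions on the set `C` of states, which is closed under
successors. -/
structure IsBisimulationOn {S' : Type} (D : MarkovChain AP S) (D' : MarkovChain AP S')
    (F : S → S') (C : Set S) : Prop where
  closed : ∀ s ∈ C, ∀ t ∈ (D.trans s).support, t ∈ C
  trans_eq : ∀ s ∈ C, D'.trans (F s) = (D.trans s).map F
  label_eq : ∀ s ∈ C, D'.label (F s) = D.label s

theorem IsBisimulationOn.ae_mem {S' : Type} {D : MarkovChain AP S} {D' : MarkovChain AP S'}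
    {F : S → S'} {C : Set S} (h : IsBisimulationOn D D' F C) {s : S} (hs : s ∈ C) :
    D.pathMeasure s {ω | ∃ i, ω i ∈ Cᶜ} = 0 := by
  by_contra h'
  exact D.mem_of_pathMeasure_exists_ne_zero (B := Cᶜ)
    (fun s t ht htC hsC => htC (h.closed s hsC t ht)) h' hs

end MarkovChain

open MarkovChain in
mutual

theorem StateFormula.sat_iff_of_isBisimulationOn {AP : Type u} {S S' : Type}
    {D : MarkovChain AP S} {D' : MarkovChain AP S'} {F : S → S'} {C : Set S}
    (h : IsBisimulationOn D D' F C) :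
    ∀ (Φ : StateFormula AP) {s : S}, s ∈ C → (Φ.Sat D s ↔ Φ.Sat D' (F s))
  | .atom a, s, hs => by
    change a ∈ _ ↔ a ∈ _
    rw [h.label_eq s hs]
  | .neg Φ, s, hs => not_congr (StateFormula.sat_iff_of_isBisimulationOn h Φ hs)
  | .and Φ₁ Φ₂, s, hs => and_congr (StateFormula.sat_iff_of_isBisimulationOn h Φ₁ hs)
    (StateFormula.sat_iff_of_isBisimulationOn h Φ₂ hs)
  | .or Φ₁ Φ₂, s, hs => or_congr (StateFormula.sat_iff_of_isBisimulationOn h Φ₁ hs)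
    (StateFormula.sat_iff_of_isBisimulationOn h Φ₂ hs)
  | .prob c q φ, s, hs => by
    let _ : MeasurableSpace S := ⊤
    let _ : MeasurableSpace S' := ⊤
    rw [sat_prob, sat_prob, ← map_pathMeasure F h.closed h.trans_eq hs,
      Measure.map_apply (measurable_comp_path F) (measurableSet_pathSat D' φ)]
    have hae : ∀ᵐ ω ∂(D.pathMeasure s), ∀ i, ω i ∈ C := by
      have := h.ae_mem hs
      refine measure_mono_null (fun ω hω => ?_) this
      simpa using hω
    rw [measure_congr (t := (fun ω => F ∘ ω) ⁻¹' {ω | φ.Sat D' ω})]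
    filter_upwards [hae] with ω hω
    exact propext (PathFormula.sat_iff_of_isBisimulationOn h φ hω)

theorem PathFormula.sat_iff_of_isBisimulationOn {AP : Type u} {S S' : Type}
    {D : MarkovChain AP S} {D' : MarkovChain AP S'} {F : S → S'} {C : Set S}
    (h : IsBisimulationOn D D' F C) :
    ∀ (φ : PathFormula AP) {ω : ℕ → S}, (∀ i, ω i ∈ C) → (φ.Sat D ω ↔ φ.Sat D' (F ∘ ω))
  | .next Φ, _, hω => StateFormula.sat_iff_of_isBisimulationOn h Φ (hω 1)
  | .until Φ₁ Φ₂, _, hω => exists_congr fun j => and_congr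
      (StateFormula.sat_iff_of_isBisimulationOn h Φ₂ (hω j))
      (forall_congr' fun k => forall_congr' fun _ =>
        StateFormula.sat_iff_of_isBisimulationOn h Φ₁ (hω k))
  | .weakUntil Φ₁ Φ₂, _, hω => or_congr
      (exists_congr fun j => and_congr
        (StateFormula.sat_iff_of_isBisimulationOn h Φ₂ (hω j))
        (forall_congr' fun k => forall_congr' fun _ =>
          StateFormula.sat_iff_of_isBisimulationOn h Φ₁ (hω k)))
      (forall_congr' fun i => StateFormula.sat_iff_of_isBisimulationOn h Φ₁ (hω i))

end

/-- The comparison complementary to `c`. -/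
def Comparison.flip : Comparison → Comparison
  | .lt => .ge
  | .gt => .le
  | .le => .gt
  | .ge => .lt

theorem Comparison.flip_holds (c : Comparison) (x q : ℝ) : c.flip.Holds x q ↔ ¬ c.Holds x q := by
  cases c <;> simp [Comparison.flip, Comparison.Holds]

mutual

/-- The positive normal form of a state formula or, if the flag is set, of its negation. -/
def StateFormula.pnf {AP : Type u} : Bool → StateFormula AP → StateFormula AP
  | false, .atom a => .atom a
  | true, .atom a => .neg (.atom a)
  | b, .neg Φ => StateFormula.pnf (!b) Φ
  | false, .and Φ₁ Φ₂ => .and (StateFormula.pnf false Φ₁) (StateFormula.pnf false Φ₂)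
  | true, .and Φ₁ Φ₂ => .or (StateFormula.pnf true Φ₁) (StateFormula.pnf true Φ₂)
  | false, .or Φ₁ Φ₂ => .or (StateFormula.pnf false Φ₁) (StateFormula.pnf false Φ₂)
  | true, .or Φ₁ Φ₂ => .and (StateFormula.pnf true Φ₁) (StateFormula.pnf true Φ₂)
  | false, .prob c q φ => .prob c q (PathFormula.pnf φ)
  | true, .prob c q φ => .prob c.flip q (PathFormula.pnf φ)

/-- The positive normal form of a path formula. -/
def PathFormula.pnf {AP : Type u} : PathFormula AP → PathFormula AP
  | .next Φ => .next (StateFormula.pnf false Φ)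
  | .until Φ₁ Φ₂ => .until (StateFormula.pnf false Φ₁) (StateFormula.pnf false Φ₂)
  | .weakUntil Φ₁ Φ₂ => .weakUntil (StateFormula.pnf false Φ₁) (StateFormula.pnf false Φ₂)

end

mutual

theorem StateFormula.isPNF_pnf {AP : Type u} :
    ∀ (b : Bool) (Φ : StateFormula AP), (StateFormula.pnf b Φ).IsPNF
  | false, .atom a => trivial
  | true, .atom a => ⟨a, rfl⟩
  | b, .neg Φ => by rw [StateFormula.pnf]; exact StateFormula.isPNF_pnf (!b) Φ
  | false, .and Φ₁ Φ₂ => ⟨StateFormula.isPNF_pnf false Φ₁, StateFormula.isPNF_pnf false Φ₂⟩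
  | true, .and Φ₁ Φ₂ => ⟨StateFormula.isPNF_pnf true Φ₁, StateFormula.isPNF_pnf true Φ₂⟩
  | false, .or Φ₁ Φ₂ => ⟨StateFormula.isPNF_pnf false Φ₁, StateFormula.isPNF_pnf false Φ₂⟩
  | true, .or Φ₁ Φ₂ => ⟨StateFormula.isPNF_pnf true Φ₁, StateFormula.isPNF_pnf true Φ₂⟩
  | false, .prob c q φ => PathFormula.isPNF_pnf φ
  | true, .prob c q φ => PathFormula.isPNF_pnf φ

theorem PathFormula.isPNF_pnf {AP : Type u} :
    ∀ φ : PathFormula AP, (PathFormula.pnf φ).IsPNF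
  | .next Φ => StateFormula.isPNF_pnf false Φ
  | .until Φ₁ Φ₂ => ⟨StateFormula.isPNF_pnf false Φ₁, StateFormula.isPNF_pnf false Φ₂⟩
  | .weakUntil Φ₁ Φ₂ => ⟨StateFormula.isPNF_pnf false Φ₁, StateFormula.isPNF_pnf false Φ₂⟩

end

mutual

theorem StateFormula.sat_pnf {AP : Type u} {S : Type} (D : MarkovChain AP S) :
    ∀ (b : Bool) (Φ : StateFormula AP) (s : S),
      (StateFormula.pnf b Φ).Sat D s ↔ (b = true ↔ ¬ Φ.Sat D s)
  | false, .atom a, s => by simp [StateFormula.pnf]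
  | true, .atom a, s => by simp [StateFormula.pnf, StateFormula.Sat]
  | b, .neg Φ, s => by
    rw [StateFormula.pnf, StateFormula.sat_pnf D (!b) Φ s, StateFormula.Sat]
    cases b <;> simp
  | false, .and Φ₁ Φ₂, s => by
    simp [StateFormula.pnf, StateFormula.Sat, StateFormula.sat_pnf D _ Φ₁ s,
      StateFormula.sat_pnf D _ Φ₂ s]
  | true, .and Φ₁ Φ₂, s => by
    simp [StateFormula.pnf, StateFormula.Sat, StateFormula.sat_pnf D _ Φ₁ s,
      StateFormula.sat_pnf D _ Φ₂ s, imp_iff_not_or]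
  | false, .or Φ₁ Φ₂, s => by
    simp [StateFormula.pnf, StateFormula.Sat, StateFormula.sat_pnf D _ Φ₁ s,
      StateFormula.sat_pnf D _ Φ₂ s, or_iff_not_imp_left]
  | true, .or Φ₁ Φ₂, s => by
    simp [StateFormula.pnf, StateFormula.Sat, StateFormula.sat_pnf D _ Φ₁ s,
      StateFormula.sat_pnf D _ Φ₂ s]
  | false, .prob c q φ, s => by
    simp [StateFormula.pnf, StateFormula.Sat, PathFormula.sat_pnf D φ]
  | true, .prob c q φ, s => by
    simp [StateFormula.pnf, StateFormula.Sat, PathFormula.sat_pnf D φ, Comparison.flip_holds]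

theorem PathFormula.sat_pnf {AP : Type u} {S : Type} (D : MarkovChain AP S) :
    ∀ (φ : PathFormula AP) (ω : ℕ → S), (PathFormula.pnf φ).Sat D ω ↔ φ.Sat D ω
  | .next Φ, ω => by
    simp [PathFormula.pnf, PathFormula.Sat, StateFormula.sat_pnf D _ Φ]
  | .until Φ₁ Φ₂, ω => by
    simp [PathFormula.pnf, PathFormula.Sat, StateFormula.sat_pnf D _ Φ₁,
      StateFormula.sat_pnf D _ Φ₂]
  | .weakUntil Φ₁ Φ₂, ω => by
    simp [PathFormula.pnf, PathFormula.Sat, StateFormula.sat_pnf D _ Φ₁,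
      StateFormula.sat_pnf D _ Φ₂]

end

namespace MarkovChain

variable {AP : Type u} {S : Type}

/-- The Markov chain `D` started in the state `s`. -/
def withInit (D : MarkovChain AP S) (s : S) : MarkovChain AP S := { D with init := s }

theorem sat_withInit (D : MarkovChain AP S) (Φ : StateFormula AP) (s₀ s : S) :
    Φ.Sat (D.withInit s₀) s ↔ Φ.Sat D s :=
  (StateFormula.sat_iff_of_isBisimulationOn (D := D) (D' := D.withInit s₀) (F := id)
    (C := Set.univ) ⟨fun _ _ _ _ => trivial, fun _ _ => (PMF.map_id _).symm, fun _ _ => rfl⟩ Φ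
    trivial).symm

theorem models_withInit (D : MarkovChain AP S) (Φ : StateFormula AP) (s : S) :
    (D.withInit s).Models Φ ↔ Φ.Sat D s :=
  D.sat_withInit Φ s s

theorem exists_path_of_pathMeasure_ne_zero (D : MarkovChain AP S) {s : S} {A : Set (ℕ → S)}
    (h : D.pathMeasure s A ≠ 0) : ∃ ω ∈ A, ω 0 = s := by
  by_contra! h'
  refine h ?_
  rw [← pathMeasure_inter_start]
  have : {ω : ℕ → S | ω 0 = s ∧ ω ∈ A} = ∅ := by
    ext ω
    simpa using fun h0 hA => h' ω hA h0
  rw [this]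
  exact measure_empty

theorem pathMeasure_ne_zero_of_start (D : MarkovChain AP S) {s : S} {A : Set (ℕ → S)}
    (h : ∀ ω : ℕ → S, ω 0 = s → ω ∈ A) : D.pathMeasure s A ≠ 0 := by
  let _ : MeasurableSpace S := ⊤
  have := D.isProbabilityMeasure_pathMeasure s
  rw [← pathMeasure_inter_start]
  have : {ω : ℕ → S | ω 0 = s ∧ ω ∈ A} = {ω | ω 0 = s ∧ ω ∈ Set.univ} := by
    ext ω
    exact and_congr_right fun h0 => iff_of_true (h ω h0) trivial
  rw [this, pathMeasure_inter_start, measure_univ]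
  exact one_ne_zero

theorem sat_next_of_succ (D : MarkovChain AP S) {Φ : StateFormula AP} {s t : S}
    (ht : t ∈ (D.trans s).support) (h : Φ.Sat D t) :
    (StateFormula.probPos (.next Φ)).Sat D s := by
  rw [sat_probPos, pathMeasure_ne_zero_iff_exists _ _ (D.measurableSet_pathSat _)]
  exact ⟨t, ht, D.pathMeasure_ne_zero_of_start fun ω h0 => by subst h0; exact h⟩

theorem sat_until_of_right (D : MarkovChain AP S) (Φ₁ : StateFormula AP) {Φ₂ : StateFormula AP}
    {s : S} (h : Φ₂.Sat D s) : (StateFormula.probPos (.until Φ₁ Φ₂)).Sat D s := by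
  rw [sat_probPos]
  exact D.pathMeasure_ne_zero_of_start fun ω h0 => ⟨0, by rwa [h0], by simp⟩

theorem sat_weakUntil_of_right (D : MarkovChain AP S) (Φ₁ : StateFormula AP)
    {Φ₂ : StateFormula AP} {s : S} (h : Φ₂.Sat D s) :
    (StateFormula.probPos (.weakUntil Φ₁ Φ₂)).Sat D s := by
  rw [sat_probPos]
  exact D.pathMeasure_ne_zero_of_start fun ω h0 => Or.inl ⟨0, by rwa [h0], by simp⟩

theorem pathSat_until_consPath (D : MarkovChain AP S) {Φ₁ Φ₂ : StateFormula AP} {s : S}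
    {ω : ℕ → S} (hs : Φ₁.Sat D s) (h : (PathFormula.until Φ₁ Φ₂).Sat D ω) :
    (PathFormula.until Φ₁ Φ₂).Sat D (consPath s ω) := by
  obtain ⟨j, hj, hk⟩ := h
  refine ⟨j + 1, hj, ?_⟩
  rintro (_ | k) hlt
  · exact hs
  · exact hk k (by omega)

theorem pathSat_weakUntil_consPath (D : MarkovChain AP S) {Φ₁ Φ₂ : StateFormula AP} {s : S}
    {ω : ℕ → S} (hs : Φ₁.Sat D s) (h : (PathFormula.weakUntil Φ₁ Φ₂).Sat D ω) :
    (PathFormula.weakUntil Φ₁ Φ₂).Sat D (consPath s ω) := by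
  rcases h with h | h
  · exact Or.inl (D.pathSat_until_consPath hs h)
  · refine Or.inr ?_
    rintro (_ | i)
    · exact hs
    · exact h i

theorem sat_probPos_of_succ (D : MarkovChain AP S) {φ : PathFormula AP} {s t : S}
    (ht : t ∈ (D.trans s).support) (hφ : ∀ ω, φ.Sat D ω → φ.Sat D (consPath s ω))
    (h : (StateFormula.probPos φ).Sat D t) : (StateFormula.probPos φ).Sat D s := by
  rw [sat_probPos] at h ⊢
  rw [pathMeasure_ne_zero_iff_exists _ _ (D.measurableSet_pathSat _)]
  let _ : MeasurableSpace S := ⊤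
  exact ⟨t, ht, fun h0 => h (measure_mono_null hφ h0)⟩

theorem sat_or_sat_of_weakUntil (D : MarkovChain AP S) {Φ₁ Φ₂ : StateFormula AP} {s : S}
    (h : (StateFormula.probPos (.weakUntil Φ₁ Φ₂)).Sat D s) : Φ₁.Sat D s ∨ Φ₂.Sat D s := by
  rw [sat_probPos] at h
  obtain ⟨ω, hω, rfl⟩ := D.exists_path_of_pathMeasure_ne_zero h
  rcases hω with ⟨_ | j, hj, hk⟩ | hω
  · exact Or.inr hj
  · exact Or.inl (hk 0 (by omega))
  · exact Or.inl (hω 0)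

theorem sat_weakUntil_of_until (D : MarkovChain AP S) {Φ₁ Φ₂ : StateFormula AP} {s : S}
    (h : (StateFormula.probPos (.until Φ₁ Φ₂)).Sat D s) :
    (StateFormula.probPos (.weakUntil Φ₁ Φ₂)).Sat D s := by
  rw [sat_probPos] at h ⊢
  let _ : MeasurableSpace S := ⊤
  exact fun h0 => h (measure_mono_null (fun _ => Or.inl) h0)

end MarkovChain

open MarkovChain

theorem StateFormula.sat_of_not_and_equivalent_bot {AP : Type u} {Φ₁ Φ₂ : StateFormula AP} {a : AP}
    (h : (StateFormula.and (.neg Φ₁) Φ₂).Equivalent (.bot a)) {S : Type} (D : MarkovChain AP S)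
    {s : S} (hs : Φ₂.Sat D s) : Φ₁.Sat D s := by
  by_contra hn
  have := h S (D.withInit s)
  rw [models_withInit, models_withInit] at this
  exact D.not_sat_bot a s (this.1 ⟨hn, hs⟩)

/-- Formulas of `PCTL_alive` are inherited by the predecessors of a state. -/
theorem PCTLAlive.sat_of_succ {AP : Type u} {Φ : StateFormula AP} (hΦ : PCTLAlive Φ) {S : Type}
    (D : MarkovChain AP S) (s t : S) (ht : t ∈ (D.trans s).support) (h : Φ.Sat D t) :
    Φ.Sat D s := by
  induction hΦ generalizing s t with
  | top a => exact D.sat_top a s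
  | and _ _ ih₁ ih₂ => exact ⟨ih₁ s t ht h.1, ih₂ s t ht h.2⟩
  | or _ _ ih₁ ih₂ => exact h.imp (ih₁ s t ht) (ih₂ s t ht)
  | weakUntil _ _ ih₁ ih₂ =>
    rcases D.sat_or_sat_of_weakUntil h with h' | h'
    · exact D.sat_probPos_of_succ ht
        (fun _ => D.pathSat_weakUntil_consPath (ih₁ s t ht h')) h
    · exact D.sat_weakUntil_of_right _ (ih₂ s t ht h')
  | @next Φ₂ _ ih =>
    rw [sat_probPos] at h
    exact D.sat_next_of_succ ht
      (D.mem_of_pathMeasure_ne_zero (B := {s | Φ₂.Sat D s}) ih 1 h)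
  | @until_of_right Φ₁ Φ₂ _ ih =>
    rw [sat_probPos] at h
    refine D.sat_until_of_right _ (ih s t ht ?_)
    let _ : MeasurableSpace S := ⊤
    refine D.mem_of_pathMeasure_exists_ne_zero (B := {s | Φ₂.Sat D s}) ih fun h0 => h ?_
    exact measure_mono_null (fun ω hω => hω.imp fun _ => And.left) h0
  | until_of_left a _ hb _ ih =>
    refine D.sat_probPos_of_succ ht (fun _ => D.pathSat_until_consPath (ih s t ht ?_)) h
    exact (D.sat_or_sat_of_weakUntil (D.sat_weakUntil_of_until h)).elim id
      (StateFormula.sat_of_not_and_equivalent_bot hb D)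
  | weakUntil_of_left a _ hb ih =>
    refine D.sat_probPos_of_succ ht (fun _ => D.pathSat_weakUntil_consPath (ih s t ht ?_)) h
    exact (D.sat_or_sat_of_weakUntil h).elim id
      (StateFormula.sat_of_not_and_equivalent_bot hb D)

/-! ### Satisfiability -/

open scoped ENNReal

/-- A decreasing sequence between `1` and `2`. -/
noncomputable def spineWeight (n : ℕ) : ℝ≥0∞ := 1 + ((n : ℝ≥0∞) + 1)⁻¹

theorem spineWeight_ne_zero (n : ℕ) : spineWeight n ≠ 0 := by simp [spineWeight]

theorem spineWeight_ne_top (n : ℕ) : spineWeight n ≠ ∞ := by simp [spineWeight]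

theorem spineWeight_div_lt_one (n : ℕ) : spineWeight (n + 1) / spineWeight n < 1 := by
  refine ENNReal.div_lt_of_lt_mul ?_
  rw [one_mul]
  refine ENNReal.add_lt_add_left ENNReal.one_ne_top ?_
  refine ENNReal.inv_lt_inv.2 ?_
  exact_mod_cast (by omega : n + 1 < n + 1 + 1)

theorem prod_spineWeight_div (n : ℕ) :
    2⁻¹ ≤ ∏ i ∈ Finset.range n, spineWeight (i + 1) / spineWeight i := by
  have h : (∏ i ∈ Finset.range n, spineWeight (i + 1) / spineWeight i) * 2 = spineWeight n := by
    induction n with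
    | zero => simp [spineWeight, one_add_one_eq_two]
    | succ n ih =>
      rw [Finset.prod_range_succ, mul_right_comm, ih,
        ENNReal.mul_div_cancel (spineWeight_ne_zero n) (spineWeight_ne_top n)]
  rw [← one_div]
  refine ENNReal.div_le_of_le_mul ?_
  rw [h]
  exact le_self_add

/-- The distribution that makes the spine continue (`none`) or branch off. -/
noncomputable def spineChoice (n : ℕ) : PMF (Option Bool) :=
  PMF.ofFintype
    (fun o => o.elim (spineWeight (n + 1) / spineWeight n)
      fun _ => (1 - spineWeight (n + 1) / spineWeight n) / 2) (by
    simp only [Fintype.sum_option, Option.elim, Fintype.sum_bool, ENNReal.add_halves]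
    exact add_tsub_cancel_of_le (spineWeight_div_lt_one n).le)

theorem mem_support_spineChoice (n : ℕ) (o : Option Bool) : o ∈ (spineChoice n).support := by
  rw [spineChoice, PMF.mem_support_ofFintype_iff]
  cases o with
  | none => exact (ENNReal.div_pos (spineWeight_ne_zero _) (spineWeight_ne_top _)).ne'
  | some b =>
    exact (ENNReal.div_pos (tsub_pos_of_lt (spineWeight_div_lt_one n)).ne' (by simp)).ne'

namespace MarkovChain

variable {AP : Type u} {S₁ S₂ : Type}

/-- The chain that runs through the natural numbers and branches off, with small probability, to
the initial state of `D₁` or of `D₂`. -/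
noncomputable def spine (D₁ : MarkovChain AP S₁) (D₂ : MarkovChain AP S₂) :
    MarkovChain AP (ℕ ⊕ (S₁ ⊕ S₂)) where
  countable :=
    haveI := D₁.countable
    haveI := D₂.countable
    inferInstance
  trans
    | .inl n => (spineChoice n).map fun o => o.elim (.inl (n + 1))
        fun b => .inr (cond b (.inl D₁.init) (.inr D₂.init))
    | .inr (.inl s) => (D₁.trans s).map fun s => .inr (.inl s)
    | .inr (.inr s) => (D₂.trans s).map fun s => .inr (.inr s)
  label
    | .inl _ => ∅
    | .inr (.inl s) => D₁.label s
    | .inr (.inr s) => D₂.label s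
  init := .inl 0

variable (D₁ : MarkovChain AP S₁) (D₂ : MarkovChain AP S₂)

theorem init_left_mem_support_spine (n : ℕ) :
    .inr (.inl D₁.init) ∈ ((spine D₁ D₂).trans (.inl n)).support :=
  (PMF.mem_support_map_iff _ _ _).2 ⟨some true, mem_support_spineChoice n _, rfl⟩

theorem init_right_mem_support_spine (n : ℕ) :
    .inr (.inr D₂.init) ∈ ((spine D₁ D₂).trans (.inl n)).support :=
  (PMF.mem_support_map_iff _ _ _).2 ⟨some false, mem_support_spineChoice n _, rfl⟩

theorem sat_spine_left (Φ : StateFormula AP) (s : S₁) :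
    Φ.Sat D₁ s ↔ Φ.Sat (spine D₁ D₂) (.inr (.inl s)) :=
  StateFormula.sat_iff_of_isBisimulationOn (D := D₁) (D' := spine D₁ D₂)
    (F := fun s => .inr (.inl s)) (C := Set.univ)
    ⟨fun _ _ _ _ => trivial, fun _ _ => rfl, fun _ _ => rfl⟩ Φ trivial

theorem sat_spine_right (Φ : StateFormula AP) (s : S₂) :
    Φ.Sat D₂ s ↔ Φ.Sat (spine D₁ D₂) (.inr (.inr s)) :=
  StateFormula.sat_iff_of_isBisimulationOn (D := D₂) (D' := spine D₁ D₂)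
    (F := fun s => .inr (.inr s)) (C := Set.univ)
    ⟨fun _ _ _ _ => trivial, fun _ _ => rfl, fun _ _ => rfl⟩ Φ trivial

theorem pathMeasure_spine_ne_zero :
    (spine D₁ D₂).pathMeasure (.inl 0) {ω | ∀ i, ω i = .inl i} ≠ 0 := by
  classical
  let _ : MeasurableSpace (ℕ ⊕ (S₁ ⊕ S₂)) := ⊤
  have := (spine D₁ D₂).isProbabilityMeasure_pathMeasure (.inl 0)
  have e : {ω : ℕ → ℕ ⊕ (S₁ ⊕ S₂) | ∀ i, ω i = .inl i} =
      ⋂ n : ℕ, {ω | ∀ i ≤ n, ω i = (fun i => .inl i) i} := by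
    ext ω
    simp only [Set.mem_ofPred_eq, Set.mem_iInter]
    exact ⟨fun h _ i _ => h i, fun h i => h i i le_rfl⟩
  have ha : Antitone fun n : ℕ =>
      {ω : ℕ → ℕ ⊕ (S₁ ⊕ S₂) | ∀ i ≤ n, ω i = (fun i => .inl i) i} :=
    fun m n hmn ω hω i hi => hω i (hi.trans hmn)
  rw [e, ha.measure_iInter
    (fun n => (measurableSet_pathCylinder n _).nullMeasurableSet) ⟨0, measure_ne_top _ _⟩]
  refine ((ENNReal.inv_pos.2 (by simp : (2 : ℝ≥0∞) ≠ ∞)).trans_le (le_iInf fun n => ?_)).ne'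
  rw [pathMeasure_cylinder, if_pos rfl]
  refine (prod_spineWeight_div n).trans (Finset.prod_le_prod' fun i _ => ?_)
  change _ ≤ ((spineChoice i).map _) _
  rw [PMF.map_apply]
  refine le_trans ?_ (ENNReal.le_tsum none)
  exact (if_pos rfl).ge

end MarkovChain

theorem PCTLAlive.sat_spine_of_left {AP : Type u} {S₁ S₂ : Type} {Φ : StateFormula AP}
    (hΦ : PCTLAlive Φ) {D₁ : MarkovChain AP S₁} (D₂ : MarkovChain AP S₂) (h : D₁.Models Φ) (n : ℕ) :
    Φ.Sat (spine D₁ D₂) (.inl n) :=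
  hΦ.sat_of_succ _ _ _ (init_left_mem_support_spine D₁ D₂ n) ((sat_spine_left D₁ D₂ Φ _).1 h)

theorem PCTLAlive.sat_spine_of_right {AP : Type u} {S₁ S₂ : Type} {Φ : StateFormula AP}
    (hΦ : PCTLAlive Φ) (D₁ : MarkovChain AP S₁) {D₂ : MarkovChain AP S₂} (h : D₂.Models Φ) (n : ℕ) :
    Φ.Sat (spine D₁ D₂) (.inl n) :=
  hΦ.sat_of_succ _ _ _ (init_right_mem_support_spine D₁ D₂ n) ((sat_spine_right D₁ D₂ Φ _).1 h)

/-- `Φ` holds in some Markov chain. -/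
def StateFormula.Satisfiable {AP : Type u} (Φ : StateFormula AP) : Prop :=
  ∃ (S : Type) (D : MarkovChain AP S), D.Models Φ

theorem PCTLAlive.satisfiable_weakUntil {AP : Type u} {Φ₁ : StateFormula AP} (hΦ : PCTLAlive Φ₁)
    (h : Φ₁.Satisfiable) (Φ₂ : StateFormula AP) :
    (StateFormula.probPos (.weakUntil Φ₁ Φ₂)).Satisfiable := by
  obtain ⟨S, D, hD⟩ := h
  refine ⟨_, spine D D, ?_⟩
  let _ : MeasurableSpace (ℕ ⊕ (S ⊕ S)) := ⊤
  refine (sat_probPos _ _ _).2 fun h0 => pathMeasure_spine_ne_zero D D ?_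
  refine measure_mono_null (fun ω hω => Or.inr fun i => ?_) h0
  rw [hω i]
  exact hΦ.sat_spine_of_left D hD i

theorem PCTLAlive.satisfiable {AP : Type u} {Φ : StateFormula AP} (hΦ : PCTLAlive Φ) :
    Φ.Satisfiable := by
  induction hΦ with
  | top a => exact ⟨Unit, ⟨inferInstance, fun _ => PMF.pure (), fun _ => ∅, ()⟩, sat_top _ a _⟩
  | and h₁ h₂ ih₁ ih₂ =>
    obtain ⟨S₁, D₁, hD₁⟩ := ih₁
    obtain ⟨S₂, D₂, hD₂⟩ := ih₂
    exact ⟨_, spine D₁ D₂, h₁.sat_spine_of_left D₂ hD₁ 0, h₂.sat_spine_of_right D₁ hD₂ 0⟩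
  | or _ _ ih _ =>
    obtain ⟨S, D, hD⟩ := ih
    exact ⟨S, D, Or.inl hD⟩
  | weakUntil h₁ _ ih _ => exact h₁.satisfiable_weakUntil ih _
  | next _ ih =>
    obtain ⟨S, D, hD⟩ := ih
    exact ⟨_, spine D D, sat_next_of_succ _ (init_left_mem_support_spine D D 0)
      ((sat_spine_left D D _ _).1 hD)⟩
  | until_of_right Φ₁ _ ih =>
    obtain ⟨S, D, hD⟩ := ih
    exact ⟨S, D, D.sat_until_of_right Φ₁ hD⟩
  | until_of_left a _ _ hn _ =>
    by_contra h
    refine hn fun S D => iff_of_false (fun hD => h ⟨S, D, D.sat_until_of_right _ hD⟩) ?_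
    exact D.not_sat_bot a _
  | weakUntil_of_left a h₁ _ ih => exact h₁.satisfiable_weakUntil ih _

namespace PMF

theorem eq_of_forall_le {α : Type*} {p q : PMF α} (h : ∀ x, p x ≤ q x) : p = q := by
  ext x
  by_contra hx
  have := ENNReal.tsum_lt_tsum p.tsum_coe_ne_top h (lt_of_le_of_ne (h x) hx)
  rw [p.tsum_coe, q.tsum_coe] at this
  exact this.false

theorem eq_map_of_injOn {α β : Type*} {p : PMF α} {q : PMF β} (F : α → β)
    (hF : Set.InjOn F p.support) (h : ∀ x ∈ p.support, q (F x) = p x) : q = p.map F := by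
  classical
  symm
  refine eq_of_forall_le fun y => ?_
  by_cases hy : ∃ x ∈ p.support, F x = y
  · obtain ⟨x, hx, rfl⟩ := hy
    rw [h x hx, map_apply, tsum_eq_single x, if_pos rfl]
    intro x' hx'
    split_ifs with he
    · by_contra h0
      exact hx' (hF ((mem_support_iff _ _).2 h0) hx he.symm)
    · rfl
  · have : p.map F y = 0 := by
      by_contra h0
      exact hy ((mem_support_map_iff F p y).1 ((mem_support_iff _ _).2 h0))
    rw [this]
    exact zero_le

theorem map_apply_of_injective {α β : Type*} (p : PMF α) {F : α → β} (hF : F.Injective) (x : α) :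
    p.map F (F x) = p x := by
  classical
  rw [map_apply, tsum_eq_single x, if_pos rfl]
  exact fun x' hx' => if_neg fun he => hx' (hF he).symm

end PMF

namespace ProbTree

variable {AP : Type u} {N N' : Type}

/-- The letter that forms the root. -/
noncomputable def root (T : ProbTree AP N) : N := T.existsUnique_root.exists.choose

theorem root_mem (T : ProbTree AP N) : [T.root] ∈ T.nodes :=
  T.existsUnique_root.exists.choose_spec

theorem ne_nil_of_mem (T : ProbTree AP N) {π : List N} (h : π ∈ T.nodes) : π ≠ [] :=
  fun h0 => T.nil_notMem (h0 ▸ h)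

theorem root_prefix (T : ProbTree AP N) {π : List N} (h : π ∈ T.nodes) : [T.root] <+: π := by
  cases π with
  | nil => exact absurd h T.nil_notMem
  | cons n l =>
    have hn : [n] ∈ T.nodes := T.prefix_closed _ h _ ⟨l, rfl⟩ (by simp)
    rw [T.existsUnique_root.unique T.root_mem hn]
    exact ⟨l, rfl⟩

theorem mem_support_prob (T : ProbTree AP N) {π π' : List N} (h : π ∈ T.nodes) :
    π' ∈ (T.prob π).support ↔ (∃ n, π' = π ++ [n]) ∧ π' ∈ T.nodes := by
  rw [← T.prob_pos_iff π h, PMF.mem_support_iff, pos_iff_ne_zero]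

/-- A property of nodes that holds for the root and passes from a node to its children holds for all
nodes. -/
theorem node_induction (T : ProbTree AP N) {p : List N → Prop} (h0 : p [T.root])
    (hs : ∀ π n, π ∈ T.nodes → π ++ [n] ∈ T.nodes → p π → p (π ++ [n])) {π : List N}
    (h : π ∈ T.nodes) : p π := by
  induction π using List.reverseRecOn with
  | nil => exact absurd h T.nil_notMem
  | append_singleton l n ih =>
    rcases eq_or_ne l [] with rfl | hl
    · rw [List.nil_append] at h ⊢
      rwa [← T.existsUnique_root.unique T.root_mem h]
    · have hl' := T.prefix_closed _ h l ⟨[n], rfl⟩ hl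
      exact hs l n hl' h (ih hl')

/-- The nodes of a tree as states of a Markov chain. -/
noncomputable def chain [Countable N] (T : ProbTree AP N) : MarkovChain AP (List N) where
  countable := inferInstance
  trans := T.prob
  label := T.label
  init := [T.root]

theorem chain_closed [Countable N] (T : ProbTree AP N) :
    ∀ π ∈ T.nodes, ∀ π' ∈ (T.chain.trans π).support, π' ∈ T.nodes :=
  fun _ h _ h' => ((T.mem_support_prob h).1 h').2

theorem Isomorphic.refl (T : ProbTree AP N) : T.Isomorphic T :=
  ⟨Equiv.refl _, fun _ _ => Iff.rfl, fun _ => rfl, fun _ _ => rfl⟩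

open Classical in
theorem Isomorphic.models_iff [Countable N] [Countable N'] {T : ProbTree AP N}
    {T' : ProbTree AP N'} (h : T.Isomorphic T') (Φ : StateFormula AP) :
    T.chain.Models Φ ↔ T'.chain.Models Φ := by
  obtain ⟨f, hp, hl, ht⟩ := h
  let F : List N → List N' := fun π => if h : π ∈ T.nodes then f ⟨π, h⟩ else []
  have hF : ∀ π (h : π ∈ T.nodes), F π = f ⟨π, h⟩ := fun π h => dif_pos h
  have hb : MarkovChain.IsBisimulationOn T.chain T'.chain F T.nodes := by
    refine ⟨T.chain_closed, fun π hπ => ?_, fun π hπ => ?_⟩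
    · refine PMF.eq_map_of_injOn F (fun x hx y hy hxy => ?_) fun x hx => ?_
      · have hx' := T.chain_closed π hπ x hx
        have hy' := T.chain_closed π hπ y hy
        rw [hF x hx', hF y hy'] at hxy
        exact congrArg Subtype.val (f.injective (Subtype.ext hxy))
      · have hx' := T.chain_closed π hπ x hx
        rw [hF x hx', hF π hπ]
        exact (ht ⟨π, hπ⟩ ⟨x, hx'⟩).symm
    · rw [hF π hπ]
      exact (hl ⟨π, hπ⟩).symm
  have hr : F [T.root] = [T'.root] := by
    rw [hF _ T.root_mem]
    have h1 := (hp ⟨_, T.root_mem⟩ (f.symm ⟨_, T'.root_mem⟩)).1 (T.root_prefix (Subtype.prop _))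
    rw [Equiv.apply_symm_apply] at h1
    rcases List.prefix_cons_iff.1 h1 with h2 | ⟨t, h2, h3⟩
    · exact absurd h2 (T'.ne_nil_of_mem (Subtype.prop _))
    · rw [h2, List.prefix_nil.1 h3]
  have := StateFormula.sat_iff_of_isBisimulationOn hb Φ T.root_mem
  rwa [hr] at this

theorem IsSuffix.exists_sat [Countable N] {T₁ T₂ : ProbTree AP N} (h : T₂.IsSuffix T₁)
    {Φ : StateFormula AP} (hΦ : T₂.chain.Models Φ) : ∃ π ∈ T₁.nodes, Φ.Sat T₁.chain π := by
  obtain ⟨π₁, -, hn, hl, hp⟩ := h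
  refine ⟨_, hn _ T₂.root_mem, (StateFormula.sat_iff_of_isBisimulationOn
    (D := T₂.chain) (F := fun π => π₁ ++ π) (C := T₂.nodes)
    ⟨T₂.chain_closed, fun π hπ => ?_, fun π hπ => (hl π hπ).symm⟩ Φ T₂.root_mem).1 hΦ⟩
  exact PMF.eq_map_of_injOn _ (List.append_right_injective π₁).injOn fun x hx =>
    (hp π hπ x (T₂.chain_closed π hπ x hx)).symm

end ProbTree

/-- The nonempty prefixes of a list, in increasing order. -/
def List.nonemptyPrefixes {α : Type*} (l : List α) : List (List α) :=
  (List.range l.length).map fun i => l.take (i + 1)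

namespace List

variable {α : Type*}

theorem nonemptyPrefixes_concat (l : List α) (a : α) :
    (l ++ [a]).nonemptyPrefixes = l.nonemptyPrefixes ++ [l ++ [a]] := by
  simp only [nonemptyPrefixes, length_append, length_singleton, range_succ, map_append,
    map_singleton]
  congr 1
  · refine map_congr_left fun i hi => ?_
    rw [mem_range] at hi
    exact take_append_of_le_length hi
  · simp [take_of_length_le]

theorem prefix_of_mem_nonemptyPrefixes {l l' : List α} (h : l' ∈ l.nonemptyPrefixes) :
    l' <+: l := by
  obtain ⟨i, -, rfl⟩ := mem_map.1 h
  exact take_prefix _ _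

theorem nonemptyPrefixes_eq_append {l : List α} (h : l ≠ []) :
    ∃ ρ, l.nonemptyPrefixes = ρ ++ [l] := by
  rw [← dropLast_append_getLast h, nonemptyPrefixes_concat]
  exact ⟨_, rfl⟩

theorem nonemptyPrefixes_prefix_iff {l l' : List α} (h : l ≠ []) :
    l.nonemptyPrefixes <+: l'.nonemptyPrefixes ↔ l <+: l' := by
  constructor
  · intro hp
    obtain ⟨ρ, hρ⟩ := nonemptyPrefixes_eq_append h
    exact prefix_of_mem_nonemptyPrefixes (hp.subset (by simp [hρ]))
  · rintro ⟨m, rfl⟩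
    induction m using reverseRecOn with
    | nil => simp
    | append_singleton m a ih =>
      rw [← append_assoc, nonemptyPrefixes_concat]
      exact ih.trans (prefix_append _ _)

end List

namespace ProbTree

variable {AP : Type u} {N : Type} [Countable N]

theorem isUnfoldingNode_nonemptyPrefixes (T : ProbTree AP N) {π : List N} (h : π ∈ T.nodes) :
    T.chain.IsUnfoldingNode π.nonemptyPrefixes := by
  refine T.node_induction (p := fun π => T.chain.IsUnfoldingNode π.nonemptyPrefixes) ?_ ?_ h
  · exact MarkovChain.IsUnfoldingNode.root
  · intro π n hπ hn ih
    obtain ⟨ρ, hρ⟩ := List.nonemptyPrefixes_eq_append (T.ne_nil_of_mem hπ)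
    rw [List.nonemptyPrefixes_concat]
    rw [hρ] at ih ⊢
    exact .step _ _ _ ih ((T.mem_support_prob hπ).2 ⟨⟨n, rfl⟩, hn⟩)

theorem exists_nonemptyPrefixes_eq (T : ProbTree AP N) {ρ : List (List N)}
    (h : T.chain.IsUnfoldingNode ρ) : ∃ π ∈ T.nodes, π.nonemptyPrefixes = ρ := by
  induction h with
  | root => exact ⟨_, T.root_mem, rfl⟩
  | step ρ s t _ ht ih =>
    obtain ⟨π, hπ, he⟩ := ih
    obtain ⟨ρ', hρ⟩ := List.nonemptyPrefixes_eq_append (T.ne_nil_of_mem hπ)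
    obtain rfl : π = s := by
      have := (List.append_inj' (hρ.symm.trans he) rfl).2
      simpa using this
    obtain ⟨⟨n, rfl⟩, hn⟩ := (T.mem_support_prob hπ).1 ht
    exact ⟨_, hn, by rw [List.nonemptyPrefixes_concat, he]⟩

theorem isomorphic_unfolding_chain (T : ProbTree AP N) : T.Isomorphic T.chain.unfolding := by
  classical
  let f : T.nodes → T.chain.unfolding.nodes :=
    fun π => ⟨π.1.nonemptyPrefixes, T.isUnfoldingNode_nonemptyPrefixes π.2⟩
  have hp : ∀ π π' : T.nodes, π.1 <+: π'.1 ↔ (f π).1 <+: (f π').1 := fun π π' =>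
    (List.nonemptyPrefixes_prefix_iff (T.ne_nil_of_mem π.2)).symm
  have hf : f.Bijective := by
    constructor
    · intro π π' h
      have h1 := (hp π π').2 (by rw [h])
      have h2 := (hp π' π).2 (by rw [h])
      exact Subtype.ext (h1.eq_of_length_le h2.length_le)
    · rintro ⟨ρ, hρ⟩
      obtain ⟨π, hπ, rfl⟩ := T.exists_nonemptyPrefixes_eq hρ
      exact ⟨⟨π, hπ⟩, rfl⟩
  have hlast : ∀ π : T.nodes, (f π).1.getLastD T.chain.init = π.1 := by
    intro π
    obtain ⟨ρ, hρ⟩ := List.nonemptyPrefixes_eq_append (T.ne_nil_of_mem π.2)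
    change π.1.nonemptyPrefixes.getLastD _ = _
    rw [hρ]
    simp
  refine ⟨Equiv.ofBijective f hf, hp, fun π => ?_, fun π π' => ?_⟩
  · change _ = T.label ((f π).1.getLastD T.chain.init)
    rw [hlast]
  · change _ = ((T.prob ((f π).1.getLastD T.chain.init)).map fun t => (f π).1 ++ [t]) (f π').1
    rw [hlast, PMF.map_apply, tsum_eq_single π'.1]
    · by_cases h0 : T.prob π.1 π'.1 = 0
      · simp [h0]
      · rw [if_pos]
        obtain ⟨⟨n, hn⟩, -⟩ := (T.mem_support_prob π.2).1 ((PMF.mem_support_iff _ _).2 h0)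
        change π'.1.nonemptyPrefixes = π.1.nonemptyPrefixes ++ [π'.1]
        rw [hn, List.nonemptyPrefixes_concat]
    · intro a ha
      refine if_neg fun he => ha ?_
      have := hlast π'
      rw [he] at this
      simpa using this

end ProbTree

theorem MarkovChain.models_chain_unfolding {AP : Type u} {S : Type} [Countable S]
    (D : MarkovChain AP S) (Φ : StateFormula AP) :
    D.unfolding.chain.Models Φ ↔ D.Models Φ := by
  have hb : IsBisimulationOn D.unfolding.chain D (fun π => π.getLastD D.init)
      D.unfolding.nodes := by
    refine ⟨D.unfolding.chain_closed, fun π _ => ?_, fun _ _ => rfl⟩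
    change _ = ((D.trans (π.getLastD D.init)).map fun t => π ++ [t]).map _
    rw [PMF.map_comp]
    conv_lhs => rw [← PMF.map_id (D.trans (π.getLastD D.init))]
    congr 1
    ext t
    simp
  have := StateFormula.sat_iff_of_isBisimulationOn hb Φ D.unfolding.root_mem
  have hr : D.unfolding.root = D.init :=
    D.unfolding.existsUnique_root.unique D.unfolding.root_mem .root
  rw [hr] at this
  refine Iff.trans ?_ this
  change Φ.Sat _ [D.unfolding.root] ↔ _
  rw [hr]

theorem StateFormula.mem_property_iff {AP : Type u} (Φ : StateFormula AP) (T : ProbTree AP ℕ) :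
    T ∈ Φ.property ↔ T.chain.Models Φ := by
  constructor
  · rintro ⟨S, D, hD, hT⟩
    have := D.countable
    rwa [hT.models_iff Φ, D.models_chain_unfolding]
  · exact fun h => ⟨_, T.chain, h, T.isomorphic_unfolding_chain⟩

theorem StateFormula.unfolding_mem_property_iff {AP : Type u} (Φ : StateFormula AP)
    (D : MarkovChain AP ℕ) : D.unfolding ∈ Φ.property ↔ D.Models Φ := by
  rw [Φ.mem_property_iff, D.models_chain_unfolding]

/-- Every Markov chain is isomorphic to a part of one with states in `ℕ`. -/
theorem MarkovChain.exists_nat {AP : Type u} {S : Type} (D : MarkovChain AP S) :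
    ∃ (D' : MarkovChain AP ℕ) (e : S → ℕ),
      IsBisimulationOn D D' e Set.univ ∧ D'.init = e D.init := by
  have := D.countable
  have : Nonempty S := ⟨D.init⟩
  obtain ⟨e, he⟩ := exists_injective_nat S
  refine ⟨⟨inferInstance, fun n => (D.trans (Function.invFun e n)).map e,
    fun n => D.label (Function.invFun e n), e D.init⟩, e,
    ⟨fun _ _ _ _ => trivial, fun s _ => ?_, fun s _ => ?_⟩, rfl⟩
  · change (D.trans (Function.invFun e (e s))).map e = _
    rw [Function.leftInverse_invFun he]
  · change D.label (Function.invFun e (e s)) = _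
    rw [Function.leftInverse_invFun he]

theorem StateFormula.property_nonempty_iff {AP : Type u} (Φ : StateFormula AP) :
    Φ.property.Nonempty ↔ Φ.Satisfiable := by
  constructor
  · rintro ⟨T, S, D, hD, -⟩
    exact ⟨S, D, hD⟩
  · rintro ⟨S, D, hD⟩
    obtain ⟨D', e, hb, he⟩ := D.exists_nat
    refine ⟨D'.unfolding, (Φ.unfolding_mem_property_iff D').2 ?_⟩
    rw [MarkovChain.Models, he]
    exact (sat_iff_of_isBisimulationOn hb Φ trivial).1 hD

theorem PCTLAlive.isAbsoluteLiveness {AP : Type u} {Φ : StateFormula AP} (hΦ : PCTLAlive Φ) :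
    IsAbsoluteLiveness Φ.property := by
  refine ⟨Φ.property_nonempty_iff.2 hΦ.satisfiable, fun T T' hT hT' => ?_⟩
  rw [Φ.mem_property_iff] at hT' ⊢
  obtain ⟨π, hπ, hsat⟩ := hT.exists_sat hT'
  refine T.node_induction (p := fun π => Φ.Sat T.chain π → Φ.Sat T.chain [T.root]) id ?_ hπ hsat
  exact fun π n hπ hn ih h =>
    ih (hΦ.sat_of_succ _ _ _ ((T.mem_support_prob hπ).2 ⟨⟨n, rfl⟩, hn⟩) h)

/-! ### Formulas that denote absolute liveness properties -/

namespace MarkovChain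

variable {AP : Type u} {S : Type}

theorem IsUnfoldingNode.cons (D : MarkovChain AP S) {s t : S} (ht : t ∈ (D.trans s).support)
    {π : List S} (h : (D.withInit t).IsUnfoldingNode π) :
    (D.withInit s).IsUnfoldingNode (s :: π) := by
  induction h with
  | root => exact .step [] s t .root ht
  | step π x y _ hy ih => exact .step (s :: π) x y ih hy

theorem unfolding_isSuffix (D : MarkovChain AP S) {s t : S} (ht : t ∈ (D.trans s).support) :
    (D.withInit t).unfolding.IsSuffix (D.withInit s).unfolding := by
  have hlast : ∀ π ∈ (D.withInit t).unfolding.nodes,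
      (s :: π).getLastD s = π.getLastD t := by
    intro π hπ
    cases π with
    | nil => exact absurd hπ (ProbTree.nil_notMem _)
    | cons x l => simp only [List.getLastD_cons]
  refine ⟨[s], .root, fun π hπ => IsUnfoldingNode.cons D ht hπ, fun π hπ => ?_,
    fun π hπ π' _ => ?_⟩
  · change D.label (π.getLastD t) = D.label ((s :: π).getLastD s)
    rw [hlast π hπ]
  · change ((D.trans (π.getLastD t)).map fun x => π ++ [x]) π' =
      ((D.trans ((s :: π).getLastD s)).map fun x => (s :: π) ++ [x]) (s :: π')
    rw [hlast π hπ, ← PMF.map_apply_of_injective _ (List.cons_injective (a := s)), PMF.map_comp]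
    rfl

end MarkovChain

theorem IsAbsoluteLiveness.sat_of_succ {AP : Type u} {Φ : StateFormula AP}
    (hΦ : IsAbsoluteLiveness Φ.property) {S : Type} (D : MarkovChain AP S) (s t : S)
    (ht : t ∈ (D.trans s).support) (h : Φ.Sat D t) : Φ.Sat D s := by
  obtain ⟨D', e, hb, -⟩ := D.exists_nat
  have hsat := fun x => StateFormula.sat_iff_of_isBisimulationOn hb Φ (Set.mem_univ x)
  have ht' : e t ∈ (D'.trans (e s)).support := by
    rw [hb.trans_eq s trivial]
    exact (PMF.mem_support_map_iff _ _ _).2 ⟨t, ht, rfl⟩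
  rw [hsat, ← models_withInit, ← StateFormula.unfolding_mem_property_iff] at h ⊢
  exact hΦ.2 _ _ (D'.unfolding_isSuffix ht') h

theorem mainTheorem11 {AP : Type u} [Finite AP] [Nonempty AP] :
    (∀ Φ : StateFormula AP, PCTLAlive Φ → IsAbsoluteLiveness Φ.property) ∧
    (∀ Φ : StateFormula AP, IsAbsoluteLiveness Φ.property →
      ∃ Φ' : StateFormula AP, PCTLAlive Φ' ∧ Φ'.IsPNF ∧ Φ.Equivalent Φ') := by
  refine ⟨fun Φ hΦ => hΦ.isAbsoluteLiveness, fun Φ hΦ => ?_⟩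
  obtain ⟨a⟩ := ‹Nonempty AP›
  have hpnf : ∀ {S : Type} (D : MarkovChain AP S) s, (Φ.pnf false).Sat D s ↔ Φ.Sat D s :=
    fun D s => by simp [StateFormula.sat_pnf D false Φ s]
  refine ⟨.probPos (.until (.top a) (Φ.pnf false)), .until_of_left a (.top a) ?_ ?_,
    ⟨⟨trivial, a, rfl⟩, Φ.isPNF_pnf false⟩, fun S D => ⟨fun h => ?_, fun h => ?_⟩⟩
  · exact fun S D => iff_of_false (fun h => h.1 (D.sat_top a _)) (D.not_sat_bot a _)
  · intro h
    obtain ⟨S, D, hD⟩ := Φ.property_nonempty_iff.1 hΦ.1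
    exact D.not_sat_bot a _ ((h S D).1 ((hpnf D _).2 hD))
  · exact D.sat_until_of_right _ ((hpnf D _).2 h)
  · rw [Models, sat_probPos] at h
    refine D.mem_of_pathMeasure_exists_ne_zero (B := {s | Φ.Sat D s}) (hΦ.sat_of_succ D) ?_
    let _ : MeasurableSpace S := ⊤
    exact fun h0 => h (measure_mono_null
      (fun ω hω => hω.imp fun _ h' => (hpnf D _).1 h'.1) h0)
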